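/- A $9$-cycle system of order $v$ is a partition of the edge set of the complete graph $K_v$ into sets (blocks), each of which is the edge set of a cycle of length $9$ in $K_v$. Two $9$-cycle systems $D_1, D_2$ of order $v$ on the same vertex set are orthogonal if every block of $D_1$ and every block of $D_2$ have at most one edge in common. Let $v$ be a positive integer with $v \equiv 1$ or $9 \pmod{18}$. Then a pair of orthogonal $9$-cycle systems of order $v$ exists if and only if $v \neq 9$. (For $v = 1$ both systems are empty.) -/

import Mathlib

/-- `D`, a set of edge sets (its blocks), is an `H`-decomposition of `G`: the blocks partition the
edge set of `G`, and each block is the edge set of a copy of `H` in `G` (a subgraph of `G` that is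
the image of an injective graph homomorphism from `H`). -/
structure IsGraphDecomposition {W V : Type*} (H : SimpleGraph W) (G : SimpleGraph V)
    (D : Set (Set (Sym2 V))) : Prop where
  nonempty_of_mem : ∀ B ∈ D, B.Nonempty
  isCopy : ∀ B ∈ D, ∃ f : SimpleGraph.Copy H G, f.toSubgraph.edgeSet = B
  pairwiseDisjoint : ∀ B ∈ D, ∀ B' ∈ D, B ≠ B' → Disjoint B B'
  sUnion_eq : ⋃₀ D = G.edgeSet

/-- An `l`-cycle system of order `v`: a decomposition of the complete graph on `v` vertices into
cycles of length `l`. -/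
def IsCycleSystem (l v : ℕ) (D : Set (Set (Sym2 (Fin v)))) : Prop :=
  IsGraphDecomposition (SimpleGraph.cycleGraph l) (⊤ : SimpleGraph (Fin v)) D

/-- Orthogonality of two decompositions, given by the edge sets of their blocks: a block of the
first and a block of the second have at most one edge in common. -/
def AreOrthogonal {V : Type*} (D₁ D₂ : Set (Set (Sym2 V))) : Prop :=
  ∀ B₁ ∈ D₁, ∀ B₂ ∈ D₂, (B₁ ∩ B₂).encard ≤ 1

/-! For `v = 9` a count excludes orthogonality: the nine edges of a block of `D₁` would lie in nine
different blocks of `D₂`, and these have 81 edges in total, whereas `K_9` has 36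
(`not_orthogonal_nine`).

For `v ≠ 1, 9` write `v = 18 * k + w` with `k` odd and `w` one of 1, 9, 19, 27, and use Bose's
construction. On the points `ZMod k × Fin 3` the triples `(i, s)`, `(j, s)`, `((i + j) / 2, s + 1)`
with `i ≠ j` cover every pair of points with different first coordinate (group) exactly once.
Replacing each point by 6 vertices turns a triple into a `K_{6,6,6}` and a group into 18 vertices.
Each group is taken together with `w` fixed vertices: group 0 carries a full `K_{18+w}`, every other
group a `K_{18+w}` without the edges of `K_w`. This splits `K_v` into edge-disjoint pieces
(`hasOrthogonalPair_boseVertex`).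

Cycles in different pieces share no edge, so orthogonal pairs on the pieces combine
(`HasOrthogonalPair.assemble`). What remains is finite: `K_{6,6,6}`, `K_19`, `K_27` and the graphs
with holes of size 9, 19, 27 are given by tables, checked on bit masks of edges
(`hasOrthogonalPair_of_check`); `K_37` and `K_45` arise by filling holes. -/

/-! ### Cycle decompositions as indexed families of cyclic sequences -/

/-- The `i`-th edge of the closed walk `c`. -/
def cycleEdge {V : Type*} (c : Fin 9 → V) (i : Fin 9) : Sym2 V := s(c i, c (i + 1))

/-- The family `c` of 9-cycles partitions the edges of `G`. -/
structure IsCycleFamily {ι V : Type*} (G : SimpleGraph V) (c : ι → Fin 9 → V) : Prop where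
  injective : ∀ k, Function.Injective (c k)
  adj : ∀ k i, G.Adj (c k i) (c k (i + 1))
  cover : ∀ x y, G.Adj x y → ∃ k i, cycleEdge (c k) i = s(x, y)
  unique : ∀ k l i j, cycleEdge (c k) i = cycleEdge (c l) j → k = l

/-- `G` has two orthogonal decompositions into 9-cycles. -/
def HasOrthogonalPair {V : Type*} (G : SimpleGraph V) : Prop :=
  ∃ (ι κ : Type) (c : ι → Fin 9 → V) (d : κ → Fin 9 → V),
    IsCycleFamily G c ∧ IsCycleFamily G d ∧
      ∀ k l i j i' j', cycleEdge (c k) i = cycleEdge (d l) i' →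
        cycleEdge (c k) j = cycleEdge (d l) j' → cycleEdge (c k) i = cycleEdge (c k) j

theorem cycleEdge_comp {V W : Type*} (f : V → W) (c : Fin 9 → V) (i : Fin 9) :
    cycleEdge (f ∘ c) i = (cycleEdge c i).map f := rfl

theorem cycleGraph_nine_adj (i j : Fin 9) :
    (SimpleGraph.cycleGraph 9).Adj i j ↔ j = i + 1 ∨ i = j + 1 := by
  rw [SimpleGraph.cycleGraph_adj]
  revert i j
  decide

/-- An injective closed walk as a copy of the 9-cycle. -/
def cycleCopy {V : Type*} {G : SimpleGraph V} (c : Fin 9 → V) (hc : Function.Injective c)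
    (hadj : ∀ i, G.Adj (c i) (c (i + 1))) : SimpleGraph.Copy (SimpleGraph.cycleGraph 9) G where
  toHom :=
    { toFun := c
      map_rel' := by
        intro i j h
        rcases (cycleGraph_nine_adj i j).1 h with rfl | rfl
        · exact hadj _
        · exact (hadj _).symm }
  injective' := hc

theorem edgeSet_toSubgraph_copy {V : Type*} {G : SimpleGraph V}
    (f : SimpleGraph.Copy (SimpleGraph.cycleGraph 9) G) :
    f.toSubgraph.edgeSet = Set.range (cycleEdge f) := by
  ext e
  induction e with
  | _ x y =>
    simp only [SimpleGraph.Copy.toSubgraph, SimpleGraph.Subgraph.mem_edgeSet,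
      SimpleGraph.Subgraph.map_adj, Relation.Map, SimpleGraph.Subgraph.top_adj, Set.mem_range,
      cycleGraph_nine_adj, cycleEdge, Sym2.eq_iff]
    constructor
    · rintro ⟨i, j, rfl | rfl, rfl, rfl⟩
      · exact ⟨i, Or.inl ⟨rfl, rfl⟩⟩
      · exact ⟨j, Or.inr ⟨rfl, rfl⟩⟩
    · rintro ⟨i, ⟨rfl, rfl⟩ | ⟨rfl, rfl⟩⟩
      · exact ⟨i, i + 1, Or.inl rfl, rfl, rfl⟩
      · exact ⟨i + 1, i, Or.inr rfl, rfl, rfl⟩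

theorem IsCycleFamily.isGraphDecomposition {ι V : Type*} {G : SimpleGraph V} {c : ι → Fin 9 → V}
    (h : IsCycleFamily G c) :
    IsGraphDecomposition (SimpleGraph.cycleGraph 9) G
      (Set.range fun k => Set.range (cycleEdge (c k))) where
  nonempty_of_mem := by
    rintro _ ⟨k, rfl⟩
    exact Set.range_nonempty _
  isCopy := by
    rintro _ ⟨k, rfl⟩
    exact ⟨cycleCopy (c k) (h.injective k) (h.adj k), edgeSet_toSubgraph_copy _⟩
  pairwiseDisjoint := by
    rintro _ ⟨k, rfl⟩ _ ⟨l, rfl⟩ hne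
    rw [Set.disjoint_left]
    rintro _ ⟨i, rfl⟩ ⟨j, hj⟩
    exact hne (by rw [h.unique _ _ _ _ hj])
  sUnion_eq := by
    ext e
    simp only [Set.sUnion_range, Set.mem_iUnion, Set.mem_range]
    constructor
    · rintro ⟨k, i, rfl⟩
      exact h.adj k i
    · induction e with
      | _ x y => exact fun hxy => h.cover x y hxy

theorem HasOrthogonalPair.exists_orthogonal {V : Type*} {G : SimpleGraph V}
    (h : HasOrthogonalPair G) : ∃ D₁ D₂ : Set (Set (Sym2 V)),
      IsGraphDecomposition (SimpleGraph.cycleGraph 9) G D₁ ∧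
        IsGraphDecomposition (SimpleGraph.cycleGraph 9) G D₂ ∧ AreOrthogonal D₁ D₂ := by
  obtain ⟨ι, κ, c, d, hc, hd, ho⟩ := h
  refine ⟨_, _, hc.isGraphDecomposition, hd.isGraphDecomposition, ?_⟩
  rintro _ ⟨k, rfl⟩ _ ⟨l, rfl⟩
  rw [Set.encard_le_one_iff]
  rintro _ _ ⟨⟨i, rfl⟩, i', hi⟩ ⟨⟨j, rfl⟩, j', hj⟩
  exact ho k l i j i' j' hi.symm hj.symm

/-! ### Combining orthogonal pairs on edge-disjoint pieces -/

section Assembly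

variable {P : Type} {V : Type*} {W : P → Type*} {G : SimpleGraph V} {H : ∀ p, SimpleGraph (W p)}

/-- A shared edge first forces the same piece, by `hunique`, and then the same cycle within it,
because `Sym2.map (f p)` is injective. -/
theorem IsCycleFamily.sigma {f : ∀ p, W p → V} (hf : ∀ p, Function.Injective (f p))
    (hadj : ∀ p a b, (H p).Adj a b → G.Adj (f p a) (f p b))
    (hcover : ∀ x y, G.Adj x y → ∃ p a b, (H p).Adj a b ∧ s(f p a, f p b) = s(x, y))
    (hunique : ∀ p q a b a' b', (H p).Adj a b → (H q).Adj a' b' →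
      s(f p a, f p b) = s(f q a', f q b') → p = q)
    {ι : P → Type} {c : ∀ p, ι p → Fin 9 → W p} (hc : ∀ p, IsCycleFamily (H p) (c p)) :
    IsCycleFamily G fun k : Σ p, ι p => f k.1 ∘ c k.1 k.2 where
  injective k := (hf _).comp ((hc _).injective _)
  adj k i := hadj _ _ _ ((hc _).adj _ _)
  cover x y hxy := by
    obtain ⟨p, a, b, hab, he⟩ := hcover x y hxy
    obtain ⟨k, i, hk⟩ := (hc p).cover a b hab
    exact ⟨⟨p, k⟩, i, by rw [cycleEdge_comp, hk, ← he]; rfl⟩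
  unique := by
    rintro ⟨p, k⟩ ⟨q, l⟩ i j h
    obtain rfl : p = q := hunique p q _ _ _ _ ((hc p).adj k i) ((hc q).adj l j) h
    rw [cycleEdge_comp, cycleEdge_comp] at h
    exact congrArg (Sigma.mk p) ((hc p).unique _ _ _ _ (Sym2.map.injective (hf p) h))

/-- Orthogonal pairs on edge-disjoint subgraphs combine to an orthogonal pair on the union. -/
theorem HasOrthogonalPair.assemble (f : ∀ p, W p → V) (hf : ∀ p, Function.Injective (f p))
    (hadj : ∀ p a b, (H p).Adj a b → G.Adj (f p a) (f p b))
    (hcover : ∀ x y, G.Adj x y → ∃ p a b, (H p).Adj a b ∧ s(f p a, f p b) = s(x, y))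
    (hunique : ∀ p q a b a' b', (H p).Adj a b → (H q).Adj a' b' →
      s(f p a, f p b) = s(f q a', f q b') → p = q)
    (h : ∀ p, HasOrthogonalPair (H p)) : HasOrthogonalPair G := by
  choose ι κ c d hc hd ho using h
  refine ⟨_, _, _, _, .sigma hf hadj hcover hunique hc, .sigma hf hadj hcover hunique hd, ?_⟩
  rintro ⟨p, k⟩ ⟨q, l⟩ i j i' j' hi hj
  -- Cycles with a common edge lie in the same piece, so orthogonality only has to hold piece by
  -- piece.
  obtain rfl : p = q := hunique p q _ _ _ _ ((hc p).adj k i) ((hd q).adj l i') hi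
  simp only [cycleEdge_comp] at hi hj ⊢
  rw [ho p k l i j i' j' (Sym2.map.injective (hf p) hi) (Sym2.map.injective (hf p) hj)]

end Assembly

theorem HasOrthogonalPair.of_iso {V W : Type*} {G : SimpleGraph V} {H : SimpleGraph W}
    (e : H ≃g G) (h : HasOrthogonalPair H) : HasOrthogonalPair G := by
  refine .assemble (P := Unit) (W := fun _ => W) (H := fun _ => H) (fun _ => e)
    (fun _ => e.injective) (fun _ a b hab => e.map_adj_iff.2 hab) (fun x y hxy => ?_)
    (fun _ _ _ _ _ _ _ _ _ => rfl) fun _ => h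
  exact ⟨(), e.symm x, e.symm y, e.symm.map_adj_iff.2 hxy, by simp⟩

/-! ### Verification of explicit decompositions -/

/-- The number whose binary digits `1` are at the given positions. -/
def bitsOf : List ℕ → ℕ
  | [] => 0
  | e :: es => 1 <<< e ||| bitsOf es

theorem testBit_bitsOf (l : List ℕ) (m : ℕ) : (bitsOf l).testBit m = true ↔ m ∈ l := by
  induction l with
  | nil => simp [bitsOf]
  | cons e es ih =>
    rw [bitsOf, Nat.one_shiftLeft, Nat.testBit_or, Bool.or_eq_true, Nat.testBit_two_pow, ih,
      List.mem_cons, decide_eq_true_eq, eq_comm]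

/-- A number `x` with `x &&& (x - 1) = 0` has at most one binary digit `1`. -/
theorem eq_of_testBit {x i j : ℕ} (h : x &&& (x - 1) = 0) (hi : x.testBit i = true)
    (hj : x.testBit j = true) : i = j := by
  wlog hij : i < j generalizing i j
  · rcases (not_lt.1 hij).lt_or_eq with hlt | heq
    · exact (this hj hi hlt).symm
    · exact heq.symm
  exfalso
  -- The last `i + 1` digits of `x` form a positive number, so subtracting 1 borrows nothing from
  -- higher digits: digit `j` survives in `x - 1`, and hence in the conjunction.
  have hr : (x % 2 ^ (i + 1)).testBit i = true := by simp [Nat.testBit_mod_two_pow, hi]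
  have hr0 := Nat.ge_two_pow_of_testBit hr
  have hpos := Nat.two_pow_pos i
  have hlt := Nat.mod_lt x (Nat.two_pow_pos (i + 1))
  have hx := Nat.div_add_mod x (2 ^ (i + 1))
  have hx' : x - 1 = 2 ^ (i + 1) * (x / 2 ^ (i + 1)) + (x % 2 ^ (i + 1) - 1) := by omega
  have hj' : (x - 1).testBit j = true := by
    rw [hx', Nat.testBit_two_pow_mul_add _ (by omega), if_neg (by omega), Nat.testBit_div_two_pow,
      Nat.sub_add_cancel hij, hj]
  have := Nat.testBit_and x (x - 1) j
  rw [h, hj, hj', Nat.zero_testBit] at this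
  exact Bool.noConfusion this

/-- The bitwise disjunction of a list of numbers. -/
def unionBits : List ℕ → ℕ
  | [] => 0
  | x :: xs => x ||| unionBits xs

theorem testBit_unionBits (l : List ℕ) (m : ℕ) :
    (unionBits l).testBit m = true ↔ ∃ x ∈ l, x.testBit m = true := by
  induction l with
  | nil => simp [unionBits]
  | cons e es ih => simp [unionBits, ih]

/-- A number that encodes the unordered pair of `a` and `b`, if these are less than `64`. -/
def edgeCode (a b : ℕ) : ℕ := if a < b then 64 * a + b else 64 * b + a

/-- The code has the sorted pair as its base-64 digits; 64 exceeds the 45 vertices of the largest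
table. -/
theorem edgeCode_eq_iff {a b a' b' : ℕ} (ha : a < 64) (hb : b < 64) (ha' : a' < 64)
    (hb' : b' < 64) : edgeCode a b = edgeCode a' b' ↔ s(a, b) = s(a', b') := by
  unfold edgeCode
  rw [Sym2.eq_iff]
  split_ifs <;> omega

theorem edgeCode_val_eq_iff {n : ℕ} (hn : n ≤ 64) (a b a' b' : Fin n) :
    edgeCode a b = edgeCode a' b' ↔ s(a, b) = s(a', b') := by
  rw [edgeCode_eq_iff (by omega) (by omega) (by omega) (by omega)]
  simp [Fin.ext_iff]

/-- The bit mask of the edges of the closed walk listed by `l`. -/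
def edgeMask (l : List ℕ) : ℕ :=
  bitsOf ((List.range 9).map fun i => edgeCode (l.getD i 0) (l.getD ((i + 1) % 9) 0))

theorem testBit_edgeMask (l : List ℕ) (m : ℕ) : (edgeMask l).testBit m = true ↔
    ∃ i : Fin 9, edgeCode (l.getD i 0) (l.getD (i + 1 : Fin 9) 0) = m := by
  simp only [edgeMask, testBit_bitsOf, List.mem_map, List.mem_range]
  constructor
  · rintro ⟨i, hi, rfl⟩
    exact ⟨⟨i, hi⟩, rfl⟩
  · rintro ⟨i, rfl⟩
    exact ⟨i, i.2, rfl⟩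

/-- A verified check that the closed walks in `L` form a decomposition into 9-cycles. -/
def checkCycles (n : ℕ) (adj : ℕ → ℕ → Bool) (L : List (List ℕ)) : Bool :=
  (L.all fun l => (List.range 9).all fun i =>
    decide (l.getD i 0 < n) && adj (l.getD i 0) (l.getD ((i + 1) % 9) 0) &&
      (List.range i).all fun j => l.getD i 0 != l.getD j 0) &&
  decide ((L.map edgeMask).Pairwise fun x y => x &&& y = 0) &&
  (List.range n).all fun a => (List.range a).all fun b =>
    !adj a b || (unionBits (L.map edgeMask)).testBit (edgeCode a b)

/-- A check that any two blocks of `L` and `M` share at most one edge. -/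
def checkOrthogonal (L M : List (List ℕ)) : Bool :=
  (L.map edgeMask).all fun x => (M.map edgeMask).all fun y =>
    ((x &&& y) &&& ((x &&& y) - 1)).beq 0

theorem checkCycles_iff {n : ℕ} {adj : ℕ → ℕ → Bool} {L : List (List ℕ)} :
    checkCycles n adj L = true ↔
    (∀ l ∈ L, ∀ i < 9, (l.getD i 0 < n ∧ adj (l.getD i 0) (l.getD ((i + 1) % 9) 0) = true) ∧
      ∀ j < i, l.getD i 0 ≠ l.getD j 0) ∧
    (L.map edgeMask).Pairwise (fun x y => x &&& y = 0) ∧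
    ∀ a < n, ∀ b < a, adj a b = true →
      (unionBits (L.map edgeMask)).testBit (edgeCode a b) = true := by
  simp only [checkCycles, Bool.and_eq_true, List.all_eq_true, List.mem_range,
    decide_eq_true_eq, Bool.or_eq_true, Bool.not_eq_true', bne_iff_ne, and_assoc,
    Bool.eq_false_iff, ne_eq, imp_iff_not_or]

section Check

variable {n : ℕ} [NeZero n] {adj : ℕ → ℕ → Bool} {L M : List (List ℕ)} {G : SimpleGraph (Fin n)}

/-- The closed walks listed by `L`. -/
def listCycle (n : ℕ) [NeZero n] (L : List (List ℕ)) (k : Fin L.length) (i : Fin 9) : Fin n :=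
  Fin.ofNat n ((L.get k).getD i 0)

/-- The check bounds the nine entries that are read by `n`, so the reduction in `Fin.ofNat` changes
nothing. -/
theorem val_listCycle (h : checkCycles n adj L = true) (k : Fin L.length) (i : Fin 9) :
    (listCycle n L k i : ℕ) = (L.get k).getD i 0 :=
  Nat.mod_eq_of_lt ((checkCycles_iff.1 h).1 _ (List.get_mem _ _) i i.2).1.1

theorem testBit_edgeMask_get (hn : n ≤ 64) (h : checkCycles n adj L = true) (k : Fin L.length)
    (a b : Fin n) : (edgeMask (L.get k)).testBit (edgeCode a b) = true ↔
      ∃ i, cycleEdge (listCycle n L k) i = s(a, b) := by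
  simp only [testBit_edgeMask, ← val_listCycle h, edgeCode_val_eq_iff hn]
  rfl

theorem isCycleFamily_listCycle (hn : n ≤ 64) (hG : ∀ a b : Fin n, G.Adj a b ↔ adj a b = true)
    (h : checkCycles n adj L = true) : IsCycleFamily G (listCycle n L) := by
  obtain ⟨h1, h2, h3⟩ := checkCycles_iff.1 h
  refine ⟨fun k i j hij => ?_, fun k i => ?_, fun x y hxy => ?_, fun k l i j hij => ?_⟩
  · rw [Fin.ext_iff, val_listCycle h, val_listCycle h] at hij
    rcases lt_trichotomy i j with hlt | heq | hlt
    · exact absurd hij.symm ((h1 _ (List.get_mem _ _) j j.2).2 i hlt)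
    · exact heq
    · exact absurd hij ((h1 _ (List.get_mem _ _) i i.2).2 j hlt)
  · rw [hG, val_listCycle h, val_listCycle h]
    exact (h1 _ (List.get_mem _ _) i i.2).1.2
  -- The covering test runs only over pairs whose first vertex is the larger one.
  · wlog hlt : y < x generalizing x y
    · obtain ⟨k, i, hk⟩ := this y x hxy.symm (lt_of_le_of_ne (not_lt.1 hlt) hxy.ne)
      exact ⟨k, i, hk.trans Sym2.eq_swap⟩
    obtain ⟨m, hm, hbit⟩ := (testBit_unionBits _ _).1 (h3 x x.2 y hlt ((hG x y).1 hxy))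
    obtain ⟨l, hl, rfl⟩ := List.mem_map.1 hm
    obtain ⟨k, rfl⟩ := List.get_of_mem hl
    exact ⟨k, (testBit_edgeMask_get hn h k x y).1 hbit⟩
  -- The masks are compared only in list order; a common edge would be a common digit of two masks
  -- with conjunction 0.
  · have aux : ∀ k l : Fin L.length, k < l → ∀ i j,
        cycleEdge (listCycle n L k) i ≠ cycleEdge (listCycle n L l) j := by
      intro k l hkl i j hij
      have h0 := List.pairwise_iff_get.1 (List.pairwise_map.1 h2) k l hkl
      have hk := (testBit_edgeMask_get hn h k (listCycle n L k i) (listCycle n L k (i + 1))).2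
        ⟨i, rfl⟩
      have hl := (testBit_edgeMask_get hn h l (listCycle n L k i) (listCycle n L k (i + 1))).2
        ⟨j, hij.symm⟩
      have hkl := Nat.testBit_and (edgeMask (L.get k)) (edgeMask (L.get l))
        (edgeCode (listCycle n L k i) (listCycle n L k (i + 1)))
      rw [hk, hl, h0, Nat.zero_testBit] at hkl
      exact Bool.noConfusion hkl
    rcases lt_trichotomy k l with hlt | heq | hlt
    · exact absurd hij (aux k l hlt i j)
    · exact heq
    · exact absurd hij.symm (aux l k hlt j i)

/-- An edge common to two blocks is a digit of the conjunction of their masks, and by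
`eq_of_testBit` the check leaves room for at most one. -/
theorem hasOrthogonalPair_of_check (hn : n ≤ 64) (hG : ∀ a b : Fin n, G.Adj a b ↔ adj a b = true)
    (hL : checkCycles n adj L = true) (hM : checkCycles n adj M = true)
    (hLM : checkOrthogonal L M = true) : HasOrthogonalPair G := by
  refine ⟨_, _, _, _, isCycleFamily_listCycle hn hG hL, isCycleFamily_listCycle hn hG hM, ?_⟩
  intro k l i j i' j' hi hj
  simp only [checkOrthogonal, List.all_eq_true, List.mem_map, forall_exists_index, and_imp,
    forall_apply_eq_imp_iff₂] at hLM
  have key : ∀ i i', cycleEdge (listCycle n L k) i = cycleEdge (listCycle n M l) i' →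
      (edgeMask (L.get k) &&& edgeMask (M.get l)).testBit
        (edgeCode (listCycle n L k i) (listCycle n L k (i + 1))) = true := by
    intro i i' hi
    rw [Nat.testBit_and, (testBit_edgeMask_get hn hL k _ _).2 ⟨i, rfl⟩,
      (testBit_edgeMask_get hn hM l _ _).2 ⟨i', hi.symm⟩]
    rfl
  have h1 := key i i' hi
  have h2 := key j j' hj
  exact (edgeCode_val_eq_iff hn _ _ _ _).1
    (eq_of_testBit (Nat.eq_of_beq_eq_true (hLM _ (List.get_mem L k) _ (List.get_mem M l))) h1 h2)

end Check

/-! ### Tables of orthogonal decompositions of the small graphs -/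

/-- The first of two orthogonal decompositions of the complete tripartite graph
with parts of size `6`. -/
def tripartiteCyclesA : List (List ℕ) :=
  [[9, 2, 6, 17, 10, 4, 13, 7, 14], [3, 12, 2, 13, 8, 16, 6, 5, 9], [4, 16, 2, 14, 6, 13, 0, 11,
   17], [15, 6, 1, 7, 16, 0, 14, 8, 2], [5, 8, 4, 7, 2, 17, 1, 9, 15], [13, 3, 8, 1, 14, 11, 5,
   12, 9], [15, 3, 7, 17, 9, 4, 11, 16, 1], [13, 1, 10, 15, 11, 12, 0, 17, 5], [6, 0, 10, 3, 16,
   5, 7, 15, 4], [12, 1, 11, 13, 10, 5, 14, 3, 6], [0, 8, 17, 3, 11, 2, 10, 12, 7], [10, 14, 4,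
   12, 8, 15, 0, 9, 16]]

/-- The second of two orthogonal decompositions of the complete tripartite graph
with parts of size `6`. -/
def tripartiteCyclesB : List (List ℕ) :=
  [[17, 9, 15, 4, 13, 2, 8, 12, 11], [13, 5, 15, 6, 12, 3, 10, 14, 9], [0, 11, 14, 7, 12, 1, 15,
   2, 17], [0, 7, 13, 3, 15, 11, 1, 9, 16], [6, 17, 1, 7, 15, 0, 13, 11, 16], [17, 7, 4, 14, 0,
   12, 5, 6, 3], [14, 5, 9, 12, 10, 15, 8, 4, 6], [3, 8, 0, 10, 17, 4, 12, 2, 7], [2, 9, 3, 16,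
   10, 5, 17, 8, 14], [7, 5, 11, 2, 6, 13, 10, 1, 16], [14, 1, 13, 8, 5, 16, 4, 11, 3], [4, 9, 0,
   6, 1, 8, 16, 2, 10]]

/-- The first of two orthogonal decompositions of the complete graph on `19` vertices. -/
def complete19CyclesA : List (List ℕ) :=
  [[10, 2, 3, 14, 7, 12, 15, 9, 4], [4, 7, 5, 11, 13, 17, 18, 9, 3], [18, 1, 0, 5, 13, 4, 15, 17,
   7], [0, 17, 12, 6, 7, 15, 18, 5, 14], [14, 1, 4, 18, 10, 7, 16, 12, 11], [9, 6, 15, 16, 2, 11,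
   7, 13, 14], [4, 6, 11, 15, 3, 12, 13, 0, 2], [12, 18, 3, 11, 10, 16, 9, 13, 2], [7, 9, 2, 5,
   10, 1, 13, 3, 8], [10, 0, 16, 8, 11, 18, 14, 17, 6], [2, 6, 14, 12, 1, 15, 8, 5, 17], [11, 1,
   7, 2, 15, 5, 3, 16, 4], [13, 16, 1, 6, 8, 2, 18, 0, 15], [10, 15, 14, 2, 1, 3, 7, 0, 9], [10,
   17, 4, 5, 9, 1, 8, 0, 3], [14, 10, 13, 18, 6, 16, 17, 8, 4], [10, 8, 13, 6, 3, 17, 11, 0, 12],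
   [8, 18, 16, 11, 9, 17, 1, 5, 12], [14, 8, 9, 12, 4, 0, 6, 5, 16]]

/-- The second of two orthogonal decompositions of the complete graph on `19` vertices. -/
def complete19CyclesB : List (List ℕ) :=
  [[1, 18, 8, 3, 6, 17, 2, 15, 14], [4, 7, 3, 16, 1, 15, 6, 13, 10], [13, 12, 5, 16, 17, 7, 14,
   18, 2], [9, 0, 17, 4, 8, 5, 13, 16, 2], [11, 17, 12, 2, 14, 13, 0, 15, 9], [9, 16, 11, 18, 4,
   2, 5, 15, 8], [18, 12, 4, 5, 10, 15, 7, 2, 0], [6, 0, 5, 9, 7, 11, 15, 12, 8], [7, 13, 18, 17,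
   14, 5, 3, 2, 8], [3, 9, 17, 10, 11, 14, 4, 13, 1], [5, 6, 10, 8, 1, 0, 14, 12, 7], [4, 15, 18,
   6, 2, 11, 3, 12, 9], [13, 17, 15, 3, 0, 7, 10, 14, 8], [5, 17, 1, 4, 16, 15, 13, 9, 18], [18,
   3, 17, 8, 11, 5, 1, 2, 10], [18, 16, 6, 11, 12, 0, 10, 1, 7], [9, 6, 12, 16, 14, 3, 13, 11, 1],
   [6, 14, 9, 10, 16, 8, 0, 11, 4], [0, 16, 7, 6, 1, 12, 10, 3, 4]]

/-- The first of two orthogonal decompositions of the complete graph on `27` vertices. -/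
def complete27CyclesA : List (List ℕ) :=
  [[22, 21, 5, 8, 17, 0, 14, 10, 25], [2, 20, 23, 10, 15, 24, 9, 22, 13], [25, 18, 12, 15, 4, 17,
   23, 13, 24], [3, 17, 14, 9, 6, 4, 19, 23, 15], [7, 23, 22, 26, 9, 0, 13, 11, 3], [3, 18, 6, 16,
   26, 4, 24, 10, 12], [25, 13, 9, 20, 17, 1, 15, 7, 6], [19, 22, 17, 24, 14, 11, 23, 16, 12],
   [23, 8, 2, 16, 22, 10, 9, 3, 6], [1, 16, 15, 2, 21, 25, 3, 14, 4], [0, 10, 26, 20, 16, 17, 2,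
   18, 4], [20, 18, 23, 14, 16, 9, 15, 11, 7], [1, 14, 5, 9, 19, 18, 24, 21, 26], [16, 0, 19, 6,
   20, 10, 7, 12, 21], [13, 15, 8, 20, 22, 0, 25, 14, 19], [11, 19, 15, 5, 16, 7, 9, 23, 0], [22,
   3, 23, 4, 8, 14, 20, 21, 6], [5, 1, 19, 8, 0, 21, 13, 7, 4], [8, 11, 2, 0, 24, 6, 26, 18, 21],
   [10, 17, 11, 5, 6, 8, 25, 7, 19], [6, 11, 26, 2, 23, 5, 24, 1, 10], [18, 10, 4, 3, 1, 22, 14,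
   7, 5], [14, 21, 11, 4, 22, 12, 13, 20, 15], [10, 21, 17, 13, 4, 16, 3, 20, 5], [12, 8, 22, 5,
   0, 18, 7, 1, 6], [25, 23, 26, 14, 13, 3, 10, 11, 1], [4, 21, 3, 5, 17, 7, 22, 15, 25], [26, 0,
   3, 19, 17, 18, 16, 8, 7], [16, 11, 22, 24, 20, 1, 9, 18, 13], [19, 26, 13, 10, 8, 18, 22, 2,
   24], [17, 6, 13, 5, 25, 9, 12, 24, 26], [13, 1, 2, 4, 12, 26, 3, 24, 8], [5, 12, 0, 20, 25, 16,
   24, 7, 2], [12, 17, 15, 21, 1, 18, 14, 2, 25], [8, 1, 23, 21, 7, 0, 6, 15, 26], [2, 12, 23, 24,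
   11, 25, 19, 21, 9], [12, 1, 0, 15, 18, 11, 9, 4, 20], [5, 19, 2, 3, 8, 9, 17, 25, 26], [11, 20,
   19, 16, 10, 2, 6, 14, 12]]

/-- The second of two orthogonal decompositions of the complete graph on `27` vertices. -/
def complete27CyclesB : List (List ℕ) :=
  [[21, 8, 3, 9, 6, 12, 10, 20, 4], [2, 26, 7, 6, 14, 1, 5, 19, 21], [25, 3, 23, 1, 10, 22, 19,
   13, 26], [25, 9, 11, 2, 7, 15, 26, 21, 14], [8, 22, 20, 7, 9, 10, 0, 3, 5], [25, 6, 3, 14, 20,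
   18, 2, 10, 8], [10, 4, 0, 17, 9, 24, 3, 18, 16], [21, 25, 1, 8, 13, 24, 0, 20, 11], [16, 2, 14,
   13, 9, 26, 1, 0, 11], [11, 19, 26, 12, 3, 4, 6, 0, 15], [20, 17, 6, 2, 0, 9, 18, 19, 12], [3,
   17, 7, 16, 12, 23, 21, 0, 13], [3, 7, 21, 20, 6, 11, 24, 15, 1], [4, 18, 24, 8, 23, 17, 15, 19,
   16], [17, 26, 4, 5, 0, 14, 8, 15, 22], [14, 9, 22, 5, 23, 7, 13, 10, 11], [2, 17, 10, 21, 5,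
   16, 6, 24, 1], [8, 12, 18, 21, 17, 11, 25, 5, 2], [19, 1, 16, 21, 24, 4, 12, 15, 3], [18, 17,
   1, 21, 13, 2, 3, 22, 26], [4, 17, 12, 9, 23, 19, 10, 7, 11], [17, 16, 3, 10, 18, 7, 25, 19,
   24], [16, 15, 18, 8, 7, 19, 2, 20, 13], [21, 9, 8, 16, 25, 15, 10, 6, 22], [24, 5, 26, 0, 23,
   11, 1, 4, 7], [22, 23, 16, 26, 14, 4, 2, 12, 7], [25, 4, 15, 5, 6, 26, 11, 18, 13], [1, 22, 24,
   25, 20, 3, 21, 15, 13], [8, 0, 25, 12, 22, 13, 4, 19, 17], [5, 11, 8, 26, 23, 10, 25, 17, 13],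
   [19, 8, 6, 18, 1, 9, 16, 22, 14], [5, 17, 14, 10, 26, 24, 16, 0, 18], [0, 22, 2, 9, 19, 6, 13,
   11, 12], [2, 23, 20, 19, 0, 7, 5, 9, 15], [20, 24, 12, 14, 18, 25, 23, 4, 9], [1, 12, 5, 10,
   24, 23, 15, 14, 7], [11, 3, 26, 20, 15, 6, 23, 18, 22], [13, 23, 14, 5, 20, 1, 6, 21, 12], [4,
   8, 20, 16, 14, 24, 2, 25, 22]]

/-- The first of two orthogonal decompositions of the complete graph on `27` vertices
with a hole of size `9`. -/
def hole9CyclesA : List (List ℕ) :=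
  [[22, 13, 14, 4, 20, 15, 0, 8, 17], [15, 26, 5, 24, 0, 1, 11, 23, 10], [3, 17, 24, 9, 22, 12, 8,
   7, 20], [22, 6, 14, 8, 9, 25, 15, 12, 1], [22, 4, 2, 7, 15, 3, 18, 1, 16], [8, 13, 23, 2, 1,
   26, 0, 7, 24], [18, 8, 5, 14, 7, 13, 17, 20, 6], [0, 16, 18, 5, 17, 26, 12, 9, 20], [20, 8, 26,
   6, 16, 3, 14, 12, 10], [25, 7, 16, 14, 22, 0, 18, 17, 11], [19, 11, 3, 12, 16, 23, 7, 1, 14],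
   [14, 10, 25, 8, 4, 26, 3, 1, 21], [12, 4, 19, 17, 15, 8, 6, 3, 23], [23, 6, 5, 1, 24, 14, 2, 3,
   9], [13, 25, 5, 0, 11, 10, 19, 2, 26], [25, 2, 9, 5, 23, 17, 10, 7, 3], [10, 9, 18, 12, 19, 6,
   25, 16, 2], [18, 7, 5, 10, 8, 21, 12, 6, 2], [24, 2, 12, 17, 7, 11, 5, 15, 13], [12, 11, 14,
   15, 2, 17, 4, 3, 24], [16, 26, 14, 23, 0, 4, 9, 11, 24], [12, 0, 21, 9, 7, 4, 6, 17, 25], [11,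
   13, 19, 8, 2, 22, 3, 5, 21], [22, 15, 1, 6, 0, 14, 18, 4, 5], [1, 17, 21, 4, 16, 13, 10, 6, 9],
   [20, 13, 4, 10, 21, 2, 11, 8, 1], [16, 9, 0, 13, 18, 10, 26, 7, 21], [14, 17, 0, 2, 13, 21, 15,
   16, 20], [15, 24, 10, 0, 19, 3, 21, 6, 11], [17, 9, 19, 1, 4, 15, 23, 8, 16], [20, 11, 22, 8,
   3, 10, 1, 13, 5], [24, 4, 23, 1, 25, 14, 9, 15, 6], [6, 7, 19, 15, 18, 11, 26, 9, 13], [16, 11,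
   4, 25, 0, 3, 13, 12, 5], [16, 10, 22, 7, 12, 20, 2, 5, 19]]

/-- The second of two orthogonal decompositions of the complete graph on `27` vertices
with a hole of size `9`. -/
def hole9CyclesB : List (List ℕ) :=
  [[23, 10, 20, 6, 15, 4, 25, 9, 0], [3, 1, 26, 12, 18, 15, 13, 4, 23], [19, 12, 14, 13, 2, 4, 24,
   10, 17], [21, 2, 0, 15, 26, 16, 19, 10, 6], [4, 10, 8, 6, 24, 7, 20, 9, 3], [9, 21, 8, 5, 16,
   7, 2, 25, 6], [23, 8, 24, 9, 15, 10, 12, 1, 14], [18, 11, 19, 5, 7, 21, 1, 25, 0], [11, 22, 2,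
   10, 14, 5, 0, 12, 6], [9, 23, 12, 25, 11, 3, 16, 10, 5], [13, 11, 20, 17, 1, 7, 22, 5, 24], [9,
   26, 10, 22, 17, 15, 7, 11, 2], [20, 5, 26, 0, 17, 6, 1, 9, 8], [7, 13, 3, 25, 16, 12, 15, 22,
   9], [25, 13, 19, 0, 22, 16, 17, 2, 14], [19, 1, 15, 21, 0, 8, 13, 17, 7], [24, 3, 17, 18, 13,
   12, 21, 5, 15], [19, 4, 17, 11, 23, 5, 13, 16, 8], [23, 1, 0, 20, 4, 9, 16, 14, 6], [4, 14, 3,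
   8, 2, 1, 16, 20, 12], [18, 10, 9, 11, 4, 21, 13, 6, 16], [13, 0, 6, 26, 11, 12, 3, 15, 20], [8,
   22, 14, 9, 17, 23, 16, 4, 7], [14, 21, 11, 24, 1, 13, 23, 15, 8], [25, 7, 12, 5, 17, 21, 3, 2,
   15], [8, 1, 5, 3, 7, 23, 2, 26, 17], [3, 0, 24, 16, 21, 10, 11, 14, 18], [15, 19, 2, 12, 22, 4,
   1, 11, 16], [24, 12, 8, 26, 13, 10, 1, 20, 14], [7, 6, 3, 22, 1, 18, 4, 26, 14], [16, 0, 14,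
   19, 9, 13, 22, 6, 2], [11, 0, 7, 26, 3, 19, 6, 18, 5], [25, 17, 12, 9, 18, 2, 20, 3, 10], [11,
   15, 14, 17, 24, 2, 5, 4, 8], [4, 6, 5, 25, 8, 18, 7, 10, 0]]

/-- The first of two orthogonal decompositions of the complete graph on `37` vertices
with a hole of size `19`. -/
def hole19CyclesA : List (List ℕ) :=
  [[22, 5, 13, 23, 0, 19, 11, 21, 12], [8, 11, 2, 21, 9, 31, 16, 23, 14], [23, 17, 18, 1, 35, 16,
   5, 30, 9], [14, 24, 9, 13, 31, 0, 26, 10, 35], [29, 7, 34, 12, 33, 17, 15, 28, 11], [13, 27,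
   10, 7, 36, 6, 16, 21, 3], [32, 2, 10, 31, 12, 4, 0, 22, 15], [15, 26, 1, 32, 14, 36, 9, 11,
   12], [20, 11, 17, 30, 8, 24, 2, 9, 14], [1, 3, 15, 25, 6, 21, 5, 31, 2], [0, 27, 5, 1, 21, 7,
   26, 17, 6], [3, 20, 10, 30, 14, 16, 4, 13, 35], [31, 14, 7, 15, 34, 16, 32, 4, 17], [8, 13, 21,
   17, 7, 4, 18, 11, 16], [4, 31, 3, 18, 13, 10, 25, 14, 1], [9, 33, 3, 8, 22, 11, 15, 29, 10],
   [13, 32, 11, 35, 15, 5, 36, 17, 22], [20, 15, 18, 16, 29, 9, 32, 12, 5], [36, 8, 29, 1, 11, 4,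
   27, 3, 12], [30, 4, 33, 14, 27, 9, 25, 11, 13], [0, 8, 10, 5, 17, 16, 1, 6, 29], [5, 8, 2, 35,
   4, 34, 6, 27, 11], [34, 0, 16, 25, 17, 10, 6, 31, 1], [5, 28, 1, 27, 16, 24, 11, 7, 0], [3, 2,
   6, 20, 16, 15, 9, 34, 17], [12, 26, 4, 3, 9, 18, 14, 5, 6], [31, 7, 25, 1, 10, 12, 13, 28, 8],
   [24, 5, 7, 27, 2, 18, 12, 14, 13], [12, 23, 1, 9, 6, 22, 16, 26, 8], [27, 12, 25, 13, 2, 5, 4,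
   9, 8], [29, 17, 1, 36, 10, 15, 24, 12, 2], [24, 17, 32, 7, 35, 12, 29, 14, 6], [17, 0, 10, 3,
   7, 22, 9, 20, 8], [36, 4, 6, 30, 7, 24, 10, 22, 2], [35, 5, 32, 0, 20, 17, 28, 6, 8], [19, 17,
   35, 0, 33, 16, 28, 7, 12], [6, 3, 23, 15, 36, 16, 12, 0, 18], [34, 5, 9, 28, 2, 19, 3, 26, 11],
   [26, 14, 21, 8, 4, 24, 3, 25, 5], [22, 4, 21, 15, 2, 25, 0, 14, 3], [33, 6, 32, 10, 21, 0, 11,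
   14, 15], [10, 28, 4, 25, 8, 33, 2, 7, 18], [29, 13, 15, 8, 1, 20, 12, 30, 3], [19, 8, 32, 3,
   28, 14, 34, 13, 7], [14, 2, 17, 12, 9, 0, 36, 13, 19], [16, 7, 9, 26, 13, 20, 4, 19, 10], [34,
   2, 30, 15, 0, 3, 36, 11, 10], [20, 2, 4, 15, 19, 5, 18, 8, 7], [5, 33, 10, 14, 22, 1, 7, 6,
   23], [23, 7, 33, 11, 3, 5, 29, 4, 10], [27, 15, 31, 11, 30, 0, 1, 13, 17], [23, 2, 0, 28, 12,
   1, 15, 6, 11], [17, 9, 16, 3, 34, 8, 23, 4, 14], [13, 33, 1, 30, 16, 19, 9, 35, 6], [2, 16, 13,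
   0, 24, 1, 19, 6, 26]]

/-- The second of two orthogonal decompositions of the complete graph on `37` vertices
with a hole of size `19`. -/
def hole19CyclesB : List (List ℕ) :=
  [[19, 10, 24, 1, 2, 9, 20, 6, 15], [13, 7, 4, 36, 14, 10, 28, 2, 32], [4, 27, 10, 9, 0, 16, 17,
   26, 1], [36, 3, 11, 2, 16, 32, 17, 19, 5], [34, 14, 30, 5, 27, 13, 8, 15, 2], [19, 3, 35, 6,
   18, 14, 0, 36, 11], [25, 9, 17, 7, 30, 16, 31, 12, 13], [8, 19, 1, 10, 25, 11, 15, 4, 12], [18,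
   12, 26, 6, 21, 10, 2, 5, 0], [17, 34, 7, 11, 12, 1, 8, 6, 29], [16, 15, 22, 8, 35, 0, 19, 9,
   1], [5, 7, 32, 8, 21, 17, 1, 0, 12], [0, 4, 14, 5, 35, 17, 31, 3, 27], [26, 16, 24, 14, 22, 9,
   27, 2, 13], [10, 18, 2, 30, 0, 7, 25, 16, 35], [15, 5, 34, 3, 9, 24, 0, 2, 14], [20, 11, 5, 26,
   0, 34, 13, 33, 16], [11, 28, 6, 12, 17, 27, 8, 0, 33], [6, 23, 15, 0, 11, 26, 4, 20, 14], [12,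
   9, 11, 31, 1, 18, 3, 15, 29], [0, 17, 5, 6, 7, 2, 24, 3, 32], [18, 5, 22, 7, 33, 8, 23, 9, 15],
   [4, 21, 2, 23, 5, 16, 22, 13, 19], [16, 29, 11, 6, 2, 25, 5, 21, 9], [9, 36, 7, 8, 17, 18, 4,
   16, 28], [35, 7, 27, 15, 10, 26, 14, 23, 1], [14, 28, 17, 33, 1, 20, 10, 0, 31], [7, 9, 31, 15,
   25, 17, 3, 16, 21], [16, 7, 19, 12, 21, 0, 6, 10, 13], [6, 16, 14, 27, 12, 24, 7, 20, 17], [15,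
   12, 33, 3, 29, 14, 9, 6, 34], [34, 12, 35, 4, 8, 36, 13, 5, 9], [14, 17, 22, 11, 16, 10, 36,
   15, 32], [22, 3, 8, 29, 4, 23, 17, 30, 12], [10, 7, 26, 15, 24, 5, 3, 4, 17], [11, 32, 12, 7,
   14, 25, 1, 29, 10], [9, 13, 1, 11, 23, 0, 22, 10, 33], [36, 12, 14, 1, 32, 4, 34, 8, 16], [1,
   5, 4, 11, 13, 0, 3, 21, 15], [30, 6, 32, 9, 35, 15, 28, 8, 11], [36, 6, 3, 7, 28, 4, 30, 15,
   17], [13, 28, 0, 20, 2, 22, 1, 27, 6], [13, 14, 19, 6, 4, 10, 34, 11, 17], [11, 14, 3, 20, 15,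
   7, 23, 16, 27], [11, 35, 14, 33, 6, 25, 4, 13, 21], [3, 12, 20, 5, 33, 2, 36, 1, 28], [32, 5,
   29, 2, 3, 26, 9, 8, 10], [2, 8, 14, 21, 1, 7, 29, 9, 4], [12, 10, 5, 8, 20, 13, 30, 3, 23], [5,
   28, 12, 16, 19, 2, 26, 8, 31], [24, 17, 2, 35, 13, 31, 6, 22, 4], [23, 10, 31, 2, 12, 25, 0,
   29, 13], [33, 4, 31, 7, 18, 11, 24, 13, 15], [18, 9, 30, 10, 3, 1, 6, 24, 8], [18, 16, 34, 1,
   30, 8, 25, 3, 13]]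

/-- The first of two orthogonal decompositions of the complete graph on `45` vertices
with a hole of size `27`. -/
def hole27CyclesA : List (List ℕ) :=
  [[22, 15, 21, 11, 37, 7, 30, 8, 10], [22, 1, 29, 7, 40, 6, 17, 18, 9], [36, 6, 15, 37, 14, 8,
   16, 31, 0], [19, 12, 7, 38, 15, 44, 9, 34, 8], [38, 9, 31, 8, 42, 4, 1, 16, 11], [30, 16, 13,
   36, 8, 5, 24, 10, 15], [9, 35, 10, 12, 28, 7, 0, 5, 39], [43, 5, 17, 37, 10, 1, 13, 32, 2],
   [26, 17, 21, 5, 42, 16, 20, 7, 13], [1, 20, 5, 19, 17, 13, 0, 16, 28], [38, 5, 18, 1, 32, 0, 4,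
   9, 12], [13, 28, 9, 6, 25, 14, 5, 1, 33], [6, 5, 22, 7, 14, 30, 10, 43, 1], [20, 9, 16, 40, 13,
   31, 15, 39, 11], [5, 31, 7, 32, 4, 24, 13, 9, 11], [22, 11, 18, 0, 26, 12, 29, 17, 4], [6, 32,
   10, 20, 12, 3, 14, 39, 8], [36, 15, 25, 17, 41, 16, 4, 21, 3], [2, 37, 1, 42, 12, 33, 7, 3,
   39], [1, 44, 11, 29, 16, 36, 7, 9, 40], [8, 17, 39, 6, 21, 10, 28, 3, 27], [40, 0, 11, 23, 16,
   32, 17, 24, 15], [14, 20, 2, 29, 4, 8, 15, 7, 43], [36, 10, 9, 0, 20, 8, 40, 14, 1], [37, 6,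
   20, 4, 12, 11, 17, 38, 8], [37, 4, 34, 16, 38, 10, 27, 5, 12], [25, 10, 11, 24, 14, 32, 5, 35,
   0], [11, 4, 2, 15, 3, 25, 7, 27, 6], [4, 19, 2, 16, 35, 13, 8, 24, 7], [13, 4, 39, 0, 38, 14,
   41, 10, 42], [23, 0, 1, 30, 12, 21, 2, 40, 10], [42, 3, 9, 19, 0, 22, 14, 28, 17], [15, 11, 1,
   34, 17, 0, 21, 14, 26], [44, 7, 18, 15, 42, 2, 1, 39, 13], [18, 4, 40, 11, 28, 2, 33, 3, 10],
   [31, 1, 38, 2, 34, 11, 19, 15, 12], [31, 4, 6, 14, 9, 27, 11, 43, 3], [13, 23, 9, 8, 41, 2, 35,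
   14, 29], [4, 5, 40, 12, 41, 7, 10, 13, 30], [35, 6, 3, 13, 22, 2, 17, 16, 7], [24, 2, 3, 26,
   11, 14, 34, 5, 9], [10, 17, 31, 6, 34, 7, 2, 14, 33], [38, 13, 2, 12, 27, 4, 23, 7, 6], [34,
   15, 13, 27, 14, 44, 8, 28, 0], [30, 2, 25, 1, 17, 40, 3, 29, 9], [36, 11, 7, 8, 33, 17, 20, 3,
   4], [21, 7, 17, 35, 4, 14, 31, 2, 8], [43, 6, 41, 0, 12, 22, 16, 37, 9], [22, 8, 35, 12, 6, 2,
   11, 32, 3], [1, 21, 9, 32, 12, 8, 43, 16, 15], [28, 5, 37, 13, 14, 42, 7, 26, 6], [21, 16, 44,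
   2, 23, 14, 18, 12, 13], [26, 1, 35, 15, 0, 37, 3, 44, 5], [18, 3, 30, 6, 33, 5, 41, 11, 8], [2,
   36, 17, 43, 12, 39, 10, 14, 0], [26, 4, 38, 3, 0, 29, 8, 25, 16], [39, 16, 3, 41, 4, 15, 14,
   19, 7], [16, 10, 29, 15, 28, 4, 44, 0, 27], [23, 17, 27, 15, 32, 8, 3, 24, 12], [6, 18, 16, 5,
   10, 31, 11, 25, 13], [29, 5, 25, 12, 44, 17, 9, 42, 6], [13, 19, 10, 44, 6, 0, 43, 15, 20],
   [14, 36, 9, 2, 27, 1, 41, 15, 17], [24, 6, 19, 3, 34, 10, 26, 8, 1], [4, 10, 2, 18, 13, 11, 33,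
   9, 25], [5, 30, 17, 22, 6, 16, 14, 12, 36], [19, 1, 9, 26, 2, 5, 15, 33, 16], [17, 3, 11, 30,
   0, 8, 23, 1, 12], [34, 12, 16, 24, 0, 33, 4, 43, 13], [13, 5, 7, 1, 3, 23, 15, 9, 41], [3, 5,
   23, 6, 10, 0, 42, 11, 35]]

/-- The second of two orthogonal decompositions of the complete graph on `45` vertices
with a hole of size `27`. -/
def hole27CyclesB : List (List ℕ) :=
  [[41, 1, 5, 43, 8, 20, 3, 36, 13], [18, 16, 23, 12, 20, 5, 13, 21, 10], [28, 1, 32, 2, 9, 35, 4,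
   33, 11], [14, 40, 6, 27, 2, 1, 34, 3, 7], [2, 24, 14, 44, 17, 11, 31, 0, 41], [34, 4, 8, 27, 9,
   22, 15, 43, 17], [15, 44, 16, 4, 37, 13, 25, 14, 29], [12, 32, 16, 39, 9, 10, 40, 1, 43], [38,
   9, 32, 3, 12, 41, 8, 28, 2], [43, 9, 28, 10, 4, 41, 11, 34, 16], [6, 34, 14, 35, 16, 19, 8, 25,
   11], [0, 8, 31, 3, 19, 15, 9, 40, 4], [20, 16, 29, 8, 6, 30, 2, 12, 0], [24, 10, 33, 8, 30, 0,
   21, 7, 15], [35, 15, 8, 5, 16, 6, 14, 19, 10], [1, 36, 9, 14, 28, 0, 35, 17, 25], [23, 13, 35,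
   11, 32, 10, 36, 0, 15], [27, 3, 16, 21, 11, 10, 41, 9, 4], [41, 3, 43, 14, 4, 24, 6, 17, 5],
   [0, 14, 12, 35, 2, 16, 13, 3, 40], [22, 11, 2, 8, 40, 12, 36, 14, 5], [17, 13, 33, 16, 8, 38,
   1, 24, 9], [35, 3, 8, 14, 11, 23, 10, 13, 1], [11, 12, 15, 36, 7, 5, 44, 8, 9], [3, 30, 12, 22,
   4, 31, 16, 15, 2], [36, 16, 42, 12, 5, 0, 13, 8, 11], [29, 2, 22, 6, 18, 17, 26, 7, 12], [17,
   20, 6, 0, 39, 3, 14, 23, 1], [21, 6, 28, 13, 18, 1, 4, 43, 2], [12, 44, 7, 23, 9, 3, 5, 35, 6],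
   [6, 44, 11, 0, 25, 15, 17, 8, 23], [38, 13, 44, 3, 10, 6, 32, 4, 11], [17, 36, 8, 42, 3, 33, 9,
   16, 10], [18, 15, 38, 16, 41, 14, 31, 5, 4], [9, 44, 10, 39, 8, 12, 28, 16, 30], [5, 26, 6, 39,
   4, 3, 15, 11, 40], [13, 6, 43, 0, 26, 10, 37, 8, 22], [34, 15, 41, 17, 16, 11, 7, 2, 13], [26,
   14, 16, 0, 27, 17, 24, 8, 1], [28, 4, 2, 33, 5, 10, 30, 1, 3], [41, 6, 15, 5, 42, 11, 29, 0,
   7], [2, 31, 13, 15, 26, 9, 34, 7, 20], [38, 0, 19, 6, 1, 33, 17, 30, 4], [36, 5, 39, 14, 1, 16,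
   40, 15, 4], [19, 4, 13, 9, 37, 0, 33, 6, 7], [3, 17, 2, 36, 6, 4, 29, 13, 26], [44, 0, 34, 8,
   18, 7, 33, 15, 1], [20, 14, 37, 7, 42, 17, 4, 26, 11], [16, 26, 2, 42, 4, 12, 33, 14, 22], [17,
   7, 22, 10, 14, 21, 3, 6, 29], [27, 7, 40, 2, 34, 12, 9, 19, 5], [12, 13, 42, 9, 21, 4, 20, 15,
   31], [14, 38, 5, 21, 1, 7, 35, 8, 32], [0, 3, 18, 5, 24, 7, 25, 4, 23], [42, 1, 22, 3, 37, 12,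
   21, 8, 10], [15, 28, 5, 2, 0, 10, 38, 7, 39], [27, 16, 37, 11, 43, 7, 31, 10, 12], [44, 4, 7,
   28, 17, 32, 5, 37, 2], [2, 25, 5, 34, 10, 1, 0, 17, 23], [15, 42, 0, 9, 25, 3, 29, 5, 30], [23,
   3, 24, 16, 7, 29, 9, 6, 5], [17, 37, 1, 27, 10, 7, 32, 0, 22], [42, 6, 25, 16, 12, 1, 11, 27,
   14], [9, 20, 10, 43, 13, 19, 2, 14, 18], [17, 31, 1, 19, 12, 18, 11, 13, 40], [7, 9, 1, 39, 17,
   19, 11, 30, 13], [6, 31, 9, 5, 11, 24, 0, 18, 2], [10, 29, 1, 20, 13, 24, 12, 39, 2], [21, 17,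
   38, 3, 11, 39, 13, 27, 15], [37, 15, 32, 13, 14, 17, 12, 38, 6], [12, 25, 10, 15, 14, 30, 7, 8,
   26]]

/-! ### Graphs with a hole, and the small cases verified by computation -/

/-- The complete graph on `18 + w` vertices without the edges among the last `w`. -/
def holeGraph (w : ℕ) : SimpleGraph (Fin (18 + w)) where
  Adj a b := a ≠ b ∧ ((a : ℕ) < 18 ∨ (b : ℕ) < 18)
  symm := ⟨fun _ _ h => ⟨h.1.symm, h.2.symm⟩⟩
  loopless := ⟨fun _ h => h.1 rfl⟩

/-- Adjacency in `holeGraph`, as a test on numbers. -/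
def holeAdj (a b : ℕ) : Bool := a != b && (decide (a < 18) || decide (b < 18))

/-- Adjacency in a complete graph, as a test on numbers. -/
def completeAdj (a b : ℕ) : Bool := a != b

theorem holeGraph_adj_iff (w : ℕ) (a b : Fin (18 + w)) :
    (holeGraph w).Adj a b ↔ holeAdj a b = true := by
  simp [holeGraph, holeAdj, Fin.ext_iff]

theorem top_adj_iff (n : ℕ) (a b : Fin n) :
    (⊤ : SimpleGraph (Fin n)).Adj a b ↔ completeAdj a b = true := by
  simp [completeAdj, Fin.ext_iff]

theorem hasOrthogonalPair_complete19 : HasOrthogonalPair (⊤ : SimpleGraph (Fin 19)) :=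
  hasOrthogonalPair_of_check (adj := completeAdj) (L := complete19CyclesA) (M := complete19CyclesB)
    (by norm_num) (top_adj_iff 19) (by decide +kernel) (by decide +kernel) (by decide +kernel)

theorem hasOrthogonalPair_complete27 : HasOrthogonalPair (⊤ : SimpleGraph (Fin 27)) :=
  hasOrthogonalPair_of_check (adj := completeAdj) (L := complete27CyclesA) (M := complete27CyclesB)
    (by norm_num) (top_adj_iff 27) (by decide +kernel) (by decide +kernel) (by decide +kernel)

/-- The complete tripartite graph with parts of size `6`. -/
def tripartiteGraph : SimpleGraph (Fin 3 × Fin 6) := (⊤ : SimpleGraph (Fin 3)).comap Prod.fst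

theorem hasOrthogonalPair_tripartite : HasOrthogonalPair tripartiteGraph := by
  refine .of_iso (H := tripartiteGraph.comap (finProdFinEquiv (m := 3) (n := 6)).symm)
    (SimpleGraph.Iso.comap _ _) ?_
  exact hasOrthogonalPair_of_check (n := 18) (L := tripartiteCyclesA) (M := tripartiteCyclesB)
    -- `finProdFinEquiv` sends `(a, b)` to `6 * a + b`, so the part of a vertex is its quotient by
    -- 6.
    (adj := fun a b => a / 6 != b / 6) (by norm_num)
    (by simp only [SimpleGraph.comap_adj, tripartiteGraph, SimpleGraph.top_adj]; decide)
    (by decide +kernel) (by decide +kernel) (by decide +kernel)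

theorem hasOrthogonalPair_hole9 : HasOrthogonalPair (holeGraph 9) :=
  hasOrthogonalPair_of_check (adj := holeAdj) (L := hole9CyclesA) (M := hole9CyclesB)
    (by norm_num) (holeGraph_adj_iff 9) (by decide +kernel) (by decide +kernel) (by decide +kernel)

theorem hasOrthogonalPair_hole19 : HasOrthogonalPair (holeGraph 19) :=
  hasOrthogonalPair_of_check (adj := holeAdj) (L := hole19CyclesA) (M := hole19CyclesB)
    (by norm_num) (holeGraph_adj_iff 19) (by decide +kernel) (by decide +kernel) (by decide +kernel)

theorem hasOrthogonalPair_hole27 : HasOrthogonalPair (holeGraph 27) :=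
  hasOrthogonalPair_of_check (adj := holeAdj) (L := hole27CyclesA) (M := hole27CyclesB)
    (by norm_num) (holeGraph_adj_iff 27) (by decide +kernel) (by decide +kernel) (by decide +kernel)

/-! ### Assembly -/

/-- The vertex set of the recursive construction. -/
abbrev BoseVertex (k w : ℕ) : Type := (ZMod k × Fin 3 × Fin 6) ⊕ Fin w

/-- For odd `k` the division is exact. Midpoints, and with them the whole construction, rest on this
inverse of 2. -/
theorem half_mul_two {k : ℕ} (hk : Odd k) : ((k + 1) / 2 : ℕ) * (2 : ZMod k) = 1 := by
  obtain ⟨m, rfl⟩ := hk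
  rw [show (2 * m + 1 + 1) / 2 = m + 1 by omega]
  have : ((2 * m + 1 : ℕ) : ZMod (2 * m + 1)) = 0 := ZMod.natCast_self _
  push_cast at this ⊢
  linear_combination this

/-- The midpoint of `i` and `j`, for odd `k`. -/
def midpointMod {k : ℕ} (i j : ZMod k) : ZMod k := ((k + 1) / 2 : ℕ) * (i + j)

theorem midpointMod_eq_iff {k : ℕ} (hk : Odd k) (i j m : ZMod k) :
    midpointMod i j = m ↔ i + j = 2 * m := by
  have h := half_mul_two hk
  unfold midpointMod
  constructor
  · rintro rfl
    linear_combination (-(i + j)) * h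
  · intro hm
    linear_combination (((k + 1) / 2 : ℕ) : ZMod k) * hm + m * h

/-- The embedding of the complete tripartite graph that belongs to the level `s` and to the
groups `i` and `j`. -/
def boseEmbedding {k : ℕ} (i j : ZMod k) (s : Fin 3) (a : Fin 3 × Fin 6) :
    ZMod k × Fin 3 × Fin 6 :=
  (![i, j, midpointMod i j] a.1, ![s, s, s + 1] a.1, a.2)

/-- The complete graph on a block of `18` vertices and `w` fixed vertices, without the edges among
the fixed vertices. -/
def blockGraph (w : ℕ) : SimpleGraph ((Fin 3 × Fin 6) ⊕ Fin w) where
  Adj a b := a ≠ b ∧ (a.isLeft = true ∨ b.isLeft = true)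
  symm := ⟨fun _ _ h => ⟨h.1.symm, h.2.symm⟩⟩
  loopless := ⟨fun _ h => h.1 rfl⟩

/-- The vertices of a block, and the fixed vertices, numbered consecutively. -/
def blockEquiv (w : ℕ) : Fin (18 + w) ≃ (Fin 3 × Fin 6) ⊕ Fin w :=
  (finSumFinEquiv (m := 3 * 6) (n := w)).symm.trans
    (Equiv.sumCongr finProdFinEquiv.symm (Equiv.refl _))

theorem isLeft_blockEquiv (w : ℕ) (a : Fin (18 + w)) :
    (blockEquiv w a).isLeft = true ↔ (a : ℕ) < 18 := by
  obtain ⟨a, rfl⟩ := (blockEquiv w).symm.surjective a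
  rw [Equiv.apply_symm_apply]
  rcases a with a | a
  · simp [blockEquiv]
  · simp [blockEquiv]

/-- `blockGraph` is isomorphic to `holeGraph`. -/
def blockIso (w : ℕ) : holeGraph w ≃g blockGraph w where
  toEquiv := blockEquiv w
  map_rel_iff' := by
    intro a b
    simp only [blockGraph, holeGraph, isLeft_blockEquiv, ne_eq, EmbeddingLike.apply_eq_iff_eq]

/-- The embedding of `blockGraph` on the group `x` and the fixed vertices. -/
def groupEmbedding {k w : ℕ} (x : ZMod k) (a : (Fin 3 × Fin 6) ⊕ Fin w) : BoseVertex k w :=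
  Sum.map (fun b => (x, b)) id a

theorem groupEmbedding_injective {k w : ℕ} (x : ZMod k) :
    Function.Injective (groupEmbedding (w := w) x) :=
  Function.Injective.sumMap (Prod.mk_right_injective x) Function.injective_id

/-- The groups and the level of the tripartite graph that contains the edge from `u` to `v`. -/
def boseOwner {k : ℕ} (u v : ZMod k × Fin 3 × Fin 6) : Sym2 (ZMod k) × Fin 3 :=
  if u.2.1 = v.2.1 then (s(u.1, v.1), u.2.1)
  -- Here `v` is on the upper level, so its group is the midpoint of that of `u` and of the
  -- reflection `2 * v.1 - u.1`.
  else if v.2.1 = u.2.1 + 1 then (s(u.1, 2 * v.1 - u.1), u.2.1)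
  else (s(v.1, 2 * u.1 - v.1), v.2.1)

theorem boseOwner_comm {k : ℕ} (u v : ZMod k × Fin 3 × Fin 6) :
    boseOwner u v = boseOwner v u := by
  obtain ⟨x, s, a⟩ := u
  obtain ⟨y, t, b⟩ := v
  unfold boseOwner
  by_cases h : s = t
  · simp [h, Sym2.eq_swap]
  -- Of two different levels modulo 3, exactly one is the successor of the other.
  · rcases (by revert s t; decide : ∀ s t : Fin 3, s ≠ t →
      (t = s + 1 ∧ s ≠ t + 1) ∨ (s = t + 1 ∧ t ≠ s + 1)) s t h with ⟨h1, h2⟩ | ⟨h1, h2⟩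
    · simp only [if_neg h, if_neg (Ne.symm h), if_pos h1, if_neg h2]
    · simp only [if_neg h, if_neg (Ne.symm h), if_pos h1, if_neg h2]

/-- A midpoint equal to an end would give `i = j`. Hence the tripartite pieces avoid all edges
inside a group. -/
theorem group_boseEmbedding_ne {k : ℕ} (hk : Odd k) {i j : ZMod k} (hij : i ≠ j) (s : Fin 3)
    {a b : Fin 3 × Fin 6} (hab : tripartiteGraph.Adj a b) :
    (boseEmbedding i j s a).1 ≠ (boseEmbedding i j s b).1 := by
  have h1 : i ≠ midpointMod i j := fun h => hij <| by
    linear_combination -(midpointMod_eq_iff hk i j i).1 h.symm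
  have h2 : j ≠ midpointMod i j := fun h => hij <| by
    linear_combination (midpointMod_eq_iff hk i j j).1 h.symm
  obtain ⟨a, a'⟩ := a
  obtain ⟨b, b'⟩ := b
  replace hab : a ≠ b := hab
  fin_cases a <;> fin_cases b <;>
    simp [boseEmbedding, hij, hij.symm, h1, h2, h1.symm, h2.symm] at hab ⊢

theorem boseEmbedding_injective {k : ℕ} (hk : Odd k) {i j : ZMod k} (hij : i ≠ j) (s : Fin 3) :
    Function.Injective (boseEmbedding i j s) := by
  intro a b hab
  by_cases h : a.1 = b.1
  · exact Prod.ext h (congrArg (fun u => u.2.2) hab)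
  · exact absurd (congrArg Prod.fst hab) (group_boseEmbedding_ne hk hij s h)

/-- Any edge of a tripartite piece determines the piece, so these pieces are pairwise edge-disjoint.
-/
theorem boseOwner_boseEmbedding {k : ℕ} (hk : Odd k) (i j : ZMod k) (s : Fin 3)
    {a b : Fin 3 × Fin 6} (hab : tripartiteGraph.Adj a b) :
    boseOwner (boseEmbedding i j s a) (boseEmbedding i j s b) = (s(i, j), s) := by
  have hm := (midpointMod_eq_iff hk i j _).1 rfl
  have h1 : 2 * midpointMod i j - i = j := by linear_combination -hm
  have h2 : 2 * midpointMod i j - j = i := by linear_combination -hm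
  have h3 : s ≠ s + 1 := by revert s; decide
  have h4 : s ≠ s + 1 + 1 := by revert s; decide
  obtain ⟨a, a'⟩ := a
  obtain ⟨b, b'⟩ := b
  replace hab : a ≠ b := hab
  fin_cases a <;> fin_cases b <;>
    simp [boseEmbedding, boseOwner, h1, h2, h3, h3.symm, h4, Sym2.eq_swap] at hab ⊢

/-- The covering half of the Bose property. Both orders of `i` and `j` are admitted because the pair
is later ordered by `Quot.out`, whose choice is unknown. -/
theorem exists_boseEmbedding {k : ℕ} (hk : Odd k) {u v : ZMod k × Fin 3 × Fin 6}
    (huv : u.1 ≠ v.1) : ∃ i j s, i ≠ j ∧ ∀ i' j', s(i', j') = s(i, j) →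
      ∃ a b, tripartiteGraph.Adj a b ∧
        s(boseEmbedding i' j' s a, boseEmbedding i' j' s b) = s(u, v) := by
  have hmid (x y : ZMod k) : midpointMod x (2 * y - x) = y ∧ midpointMod (2 * y - x) x = y :=
    ⟨(midpointMod_eq_iff hk _ _ _).2 (by ring), (midpointMod_eq_iff hk _ _ _).2 (by ring)⟩
  have hne {x y : ZMod k} (hxy : x ≠ y) : x ≠ 2 * y - x := fun h => hxy <| by
    have h' : x = midpointMod x x := ((midpointMod_eq_iff hk x x x).2 (by ring)).symm
    rw [h', midpointMod_eq_iff hk]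
    linear_combination h
  have hlevel : ∀ s t : Fin 3, s = t ∨ t = s + 1 ∨ s = t + 1 := by decide
  have key (x y : ZMod k) (hxy : x ≠ y) (s : Fin 3) (c d : Fin 6) :
      ∃ i j s', i ≠ j ∧ ∀ i' j', s(i', j') = s(i, j) → ∃ a b, tripartiteGraph.Adj a b ∧
        s(boseEmbedding i' j' s' a, boseEmbedding i' j' s' b) = s((x, s, c), (y, s + 1, d)) := by
    refine ⟨x, 2 * y - x, s, hne hxy, fun i' j' h => ?_⟩
    rcases Sym2.eq_iff.1 h with ⟨rfl, rfl⟩ | ⟨rfl, rfl⟩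
    · exact ⟨(0, c), (2, d), by simp [tripartiteGraph], by simp [boseEmbedding, hmid]⟩
    · exact ⟨(1, c), (2, d), by simp [tripartiteGraph], by simp [boseEmbedding, hmid]⟩
  obtain ⟨x, s, c⟩ := u
  obtain ⟨y, t, d⟩ := v
  rcases hlevel s t with rfl | rfl | rfl
  · refine ⟨x, y, s, huv, fun i' j' h => ?_⟩
    rcases Sym2.eq_iff.1 h with ⟨rfl, rfl⟩ | ⟨rfl, rfl⟩
    · exact ⟨(0, c), (1, d), by simp [tripartiteGraph], by simp [boseEmbedding]⟩
    · exact ⟨(1, c), (0, d), by simp [tripartiteGraph], by simp [boseEmbedding]⟩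
  · exact key x y huv s c d
  · simpa only [Sym2.eq_swap (a := (x, t + 1, c))] using key y x huv.symm t d c

/-- The recursive construction: a complete graph on `k` groups of size `18` and `w` fixed vertices,
with `k` odd, is the union of complete graphs with a hole on the fixed vertices and a group, of one
complete graph, and of complete tripartite graphs. -/
theorem hasOrthogonalPair_boseVertex {k w : ℕ} (hk : Odd k)
    (hhole : HasOrthogonalPair (holeGraph w))
    (hfull : HasOrthogonalPair (⊤ : SimpleGraph (Fin (18 + w)))) :
    HasOrthogonalPair (⊤ : SimpleGraph (BoseVertex k w)) := by
  classical
  let P : Type := ZMod k ⊕ ({e : Sym2 (ZMod k) // ¬ e.IsDiag} × Fin 3)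
  let W : P → Type := fun p => match p with
    | .inl _ => (Fin 3 × Fin 6) ⊕ Fin w
    | .inr _ => Fin 3 × Fin 6
  let H : ∀ p : P, SimpleGraph (W p) := fun p => match p with
    -- Exactly one group carries the edges among the fixed vertices; group 0 is an arbitrary choice.
    | .inl x => if x = 0 then (⊤ : SimpleGraph ((Fin 3 × Fin 6) ⊕ Fin w)) else blockGraph w
    | .inr _ => tripartiteGraph
  let f : ∀ p : P, W p → BoseVertex k w := fun p => match p with
    | .inl x => groupEmbedding x
    | .inr q => fun a => .inl (boseEmbedding q.1.1.out.1 q.1.1.out.2 q.2 a)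
  have hout (e : Sym2 (ZMod k)) : s(e.out.1, e.out.2) = e := Quot.out_eq e
  have hout_ne (e : {e : Sym2 (ZMod k) // ¬ e.IsDiag}) : e.1.out.1 ≠ e.1.out.2 := by
    have := e.2
    rwa [← hout e.1, Sym2.mk_isDiag_iff] at this
  have hf : ∀ p, Function.Injective (f p) := by
    rintro (x | q)
    · exact groupEmbedding_injective x
    · exact Sum.inl_injective.comp (boseEmbedding_injective hk (hout_ne q.1) q.2)
  -- An edge of a block stays in one group or meets a fixed vertex; a tripartite edge does neither.
  have hdisj (x : ZMod k) (q) (a b : W (.inl x)) (a' b' : W (.inr q))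
      (hab' : tripartiteGraph.Adj a' b')
      (he : s(f (.inl x) a, f (.inl x) b) = s(f (.inr q) a', f (.inr q) b')) : False := by
    have hne := group_boseEmbedding_ne hk (hout_ne q.1) q.2 hab'
    simp only [f] at he
    rcases a with a | a <;> rcases b with b | b <;>
      simp only [groupEmbedding, Sum.map_inl, Sum.map_inr, id, Sym2.eq_iff, Sum.inl.injEq,
        reduceCtorEq, false_and, and_false, or_self] at he
    rcases he with ⟨h1, h2⟩ | ⟨h1, h2⟩ <;> exact hne (by rw [← h1, ← h2])
  refine .assemble (P := P) (W := W) (H := H) f hf ?_ ?_ ?_ ?_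
  · exact fun p a b hab => (hf p).ne hab.ne
  · rintro (u | u) (v | v) huv
    · by_cases h : u.1 = v.1
      · obtain ⟨x, a⟩ := u
        obtain ⟨y, b⟩ := v
        obtain rfl : x = y := h
        refine ⟨.inl x, .inl a, .inl b, ?_, rfl⟩
        have hab : a ≠ b := fun h => huv (by rw [h])
        simp only [H]
        split_ifs
        · exact Sum.inl_injective.ne hab
        · exact ⟨Sum.inl_injective.ne hab, Or.inl rfl⟩
      · obtain ⟨i, j, s, hij, h⟩ := exists_boseEmbedding hk h
        obtain ⟨a, b, hab, he⟩ := h _ _ (hout s(i, j))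
        exact ⟨.inr (⟨s(i, j), hij⟩, s), a, b, hab, congrArg (Sym2.map Sum.inl) he⟩
    · refine ⟨.inl u.1, .inl u.2, .inr v, ?_, rfl⟩
      simp only [H]
      split_ifs <;> simp [blockGraph]
    · refine ⟨.inl v.1, .inr u, .inl v.2, ?_, rfl⟩
      simp only [H]
      split_ifs <;> simp [blockGraph]
    · refine ⟨.inl 0, .inr u, .inr v, ?_, rfl⟩
      simp only [H, if_true]
      exact fun h => huv (congrArg Sum.inr (Sum.inr_injective h))
  · rintro (x | q) (y | r) a b a' b' hab hab' he
    · by_cases hxy : x = y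
      · rw [hxy]
      -- For `x ≠ y` a common edge has both ends among the fixed vertices, and only group 0 has such
      -- edges.
      exfalso
      simp only [H] at hab hab'
      simp only [f] at he
      rcases a with a | a <;> rcases b with b | b <;> rcases a' with a' | a' <;>
        rcases b' with b' | b' <;>
        simp [groupEmbedding, hxy] at he
      split_ifs at hab hab' with hx hy hy
      · exact hxy (hx.trans hy.symm)
      · simp [blockGraph] at hab'
      · simp [blockGraph] at hab
      · simp [blockGraph] at hab
    · exact (hdisj x r a b a' b' hab' he).elim
    · exact (hdisj y q a' b' a b hab he.symm).elim
    · have he' := Sym2.map.injective Sum.inl_injective (a₁ := s(_, _)) (a₂ := s(_, _)) he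
      have howner : boseOwner (boseEmbedding q.1.1.out.1 q.1.1.out.2 q.2 a)
          (boseEmbedding q.1.1.out.1 q.1.1.out.2 q.2 b) =
          boseOwner (boseEmbedding r.1.1.out.1 r.1.1.out.2 r.2 a')
            (boseEmbedding r.1.1.out.1 r.1.1.out.2 r.2 b') := by
        rcases Sym2.eq_iff.1 he' with ⟨h1, h2⟩ | ⟨h1, h2⟩
        · rw [h1, h2]
        · rw [h1, h2, boseOwner_comm]
      rw [boseOwner_boseEmbedding hk _ _ _ hab, boseOwner_boseEmbedding hk _ _ _ hab', hout, hout,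
        Prod.mk.injEq] at howner
      rw [Prod.ext (Subtype.ext howner.1) howner.2]
  · rintro (x | q)
    · simp only [H]
      split_ifs
      · exact hfull.of_iso (SimpleGraph.Iso.completeGraph (blockEquiv w))
      · exact hhole.of_iso (blockIso w)
    · exact hasOrthogonalPair_tripartite

theorem hasOrthogonalPair_complete {k w : ℕ} (hk : Odd k)
    (hhole : HasOrthogonalPair (holeGraph w))
    (hfull : HasOrthogonalPair (⊤ : SimpleGraph (Fin (18 + w)))) :
    HasOrthogonalPair (⊤ : SimpleGraph (Fin (18 * k + w))) := by
  have : NeZero k := ⟨hk.pos.ne'⟩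
  refine (hasOrthogonalPair_boseVertex hk hhole hfull).of_iso
    (SimpleGraph.Iso.completeGraph (Fintype.equivFinOfCardEq ?_))
  simp [ZMod.card]
  ring

/-- A hole can be filled. -/
theorem HasOrthogonalPair.fill {w : ℕ} (hhole : HasOrthogonalPair (holeGraph w))
    (h : HasOrthogonalPair (⊤ : SimpleGraph (Fin w))) :
    HasOrthogonalPair (⊤ : SimpleGraph (Fin (18 + w))) := by
  let W : Bool → Type := fun p => match p with
    | true => Fin (18 + w)
    | false => Fin w
  let H : ∀ p, SimpleGraph (W p) := fun p => match p with
    | true => holeGraph w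
    | false => ⊤
  let f : ∀ p, W p → Fin (18 + w) := fun p => match p with
    | true => id
    | false => Fin.natAdd 18
  have hf : ∀ p, Function.Injective (f p) := by
    rintro (_ | _)
    · exact Fin.natAdd_injective w 18
    · exact Function.injective_id
  have hdisj (a b : Fin (18 + w)) (a' b' : Fin w) (hab : (holeGraph w).Adj a b)
      (he : s(a, b) = s(Fin.natAdd 18 a', Fin.natAdd 18 b')) : False := by
    rcases Sym2.eq_iff.1 he with ⟨rfl, rfl⟩ | ⟨rfl, rfl⟩ <;> simp [holeGraph] at hab
  refine .assemble (W := W) (H := H) f hf (fun p a b hab => (hf p).ne hab.ne) ?_ ?_ ?_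
  · intro x y hxy
    by_cases h : (x : ℕ) < 18 ∨ (y : ℕ) < 18
    · exact ⟨true, x, y, ⟨hxy, h⟩, rfl⟩
    · push Not at h
      obtain ⟨a, rfl⟩ : ∃ a, Fin.natAdd 18 a = x := ⟨Fin.subNat 18 (x.cast (by omega)) h.1,
        by ext; simp⟩
      obtain ⟨b, rfl⟩ : ∃ a, Fin.natAdd 18 a = y := ⟨Fin.subNat 18 (y.cast (by omega)) h.2,
        by ext; simp⟩
      exact ⟨false, a, b, fun h => hxy (by rw [h]), rfl⟩
  · rintro (_ | _) (_ | _) a b a' b' hab hab' he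
    · rfl
    · exact (hdisj _ _ _ _ hab' he.symm).elim
    · exact (hdisj _ _ _ _ hab he).elim
    · rfl
  · rintro (_ | _)
    · exact h
    · exact hhole

/-! ### Choice of `k` and `w` -/

/-- A hole on one vertex removes no edge, so `K_19` itself serves as the piece for `w = 1`. -/
theorem holeGraph_one : holeGraph 1 = ⊤ := by
  ext a b
  simp only [holeGraph, SimpleGraph.top_adj, ne_eq, Fin.ext_iff]
  omega

theorem hasOrthogonalPair_of_modEq {v : ℕ} (hv : v ≡ 1 [MOD 18] ∨ v ≡ 9 [MOD 18]) (h1 : v ≠ 1)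
    (h9 : v ≠ 9) : HasOrthogonalPair (⊤ : SimpleGraph (Fin v)) := by
  have h19 := hasOrthogonalPair_complete19
  have h27 := hasOrthogonalPair_complete27
  have hhole1 : HasOrthogonalPair (holeGraph 1) := by
    rw [holeGraph_one]
    exact h19
  -- If `v / 18` is even, one group of 18 moves into `w` to make `k` odd. This needs `v / 18 > 0`,
  -- which holds since `v` is neither 1 nor 9.
  obtain ⟨k, w, rfl, hk, hw⟩ : ∃ k w, v = 18 * k + w ∧ Odd k ∧
      (w = 1 ∨ w = 9 ∨ w = 19 ∨ w = 27) := by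
    unfold Nat.ModEq at hv
    have : v = 18 * (v / 18) + v % 18 := by omega
    rcases Nat.even_or_odd (v / 18) with ⟨m, hm⟩ | hodd
    · exact ⟨v / 18 - 1, v % 18 + 18, by omega, ⟨m - 1, by omega⟩, by omega⟩
    · exact ⟨v / 18, v % 18, by omega, hodd, by omega⟩
  rcases hw with rfl | rfl | rfl | rfl
  · exact hasOrthogonalPair_complete hk hhole1 h19
  · exact hasOrthogonalPair_complete hk hasOrthogonalPair_hole9 h27
  · exact hasOrthogonalPair_complete hk hasOrthogonalPair_hole19
      (.fill hasOrthogonalPair_hole19 h19)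
  · exact hasOrthogonalPair_complete hk hasOrthogonalPair_hole27
      (.fill hasOrthogonalPair_hole27 h27)

/-! ### Nonexistence for order nine -/

theorem cycleEdge_injective {V : Type*} {c : Fin 9 → V} (hc : Function.Injective c) :
    Function.Injective (cycleEdge c) := by
  intro i j h
  simp only [cycleEdge, Sym2.eq_iff, hc.eq_iff] at h
  revert i j
  decide

theorem not_orthogonal_nine (D₁ D₂ : Set (Set (Sym2 (Fin 9)))) (h₁ : IsCycleSystem 9 9 D₁)
    (h₂ : IsCycleSystem 9 9 D₂) : ¬ AreOrthogonal D₁ D₂ := by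
  intro ho
  have h01 : s((0 : Fin 9), 1) ∈ ⋃₀ D₁ := by
    rw [h₁.sUnion_eq]
    decide
  obtain ⟨B, hB, -⟩ := h01
  obtain ⟨f, rfl⟩ := h₁.isCopy B hB
  have hblock (i : Fin 9) : ∃ C ∈ D₂, cycleEdge f i ∈ C := by
    have : cycleEdge f i ∈ ⋃₀ D₂ := by
      rw [h₂.sUnion_eq]
      exact f.toHom.map_adj ((cycleGraph_nine_adj _ _).2 (Or.inl rfl))
    exact this
  choose C hC hfC using hblock
  -- Orthogonality: a block of `D₂` containing two of the nine edges would share both with the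
  -- chosen block of `D₁`.
  have hCinj : Function.Injective C := by
    intro i j hij
    apply cycleEdge_injective f.injective
    refine Set.encard_le_one_iff.1 (ho _ hB _ (hC i)) _ _ ⟨?_, hfC i⟩ ⟨?_, hij ▸ hfC j⟩ <;>
    · rw [edgeSet_toSubgraph_copy]
      exact Set.mem_range_self _
  choose g hg using fun i => h₂.isCopy (C i) (hC i)
  have hmem (p : Fin 9 × Fin 9) : cycleEdge (g p.1) p.2 ∈ C p.1 := by
    rw [← hg, edgeSet_toSubgraph_copy]
    exact Set.mem_range_self _
  have hinj : Function.Injective fun p : Fin 9 × Fin 9 => cycleEdge (g p.1) p.2 := by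
    rintro ⟨i, a⟩ ⟨j, b⟩ h
    obtain rfl : i = j := by
      by_contra hij
      refine Set.disjoint_left.1 (h₂.pairwiseDisjoint _ (hC i) _ (hC j) (hCinj.ne hij))
        (hmem (i, a)) ?_
      rw [show cycleEdge (g i) a = cycleEdge (g j) b from h]
      exact hmem (j, b)
    exact congrArg (Prod.mk i) (cycleEdge_injective (g i).injective h)
  -- `Sym2 (Fin 9)` has 45 elements, including the 9 diagonal ones; this crude bound is already
  -- below 81.
  have := Fintype.card_le_of_injective _ hinj
  rw [Sym2.card] at this
  simp [Nat.choose] at this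

theorem mainTheorem2 (v : ℕ) (hv : v ≡ 1 [MOD 18] ∨ v ≡ 9 [MOD 18]) :
    (∃ D₁ D₂ : Set (Set (Sym2 (Fin v))),
      IsCycleSystem 9 v D₁ ∧ IsCycleSystem 9 v D₂ ∧ AreOrthogonal D₁ D₂) ↔ v ≠ 9 := by
  constructor
  · rintro ⟨D₁, D₂, h₁, h₂, ho⟩ rfl
    exact not_orthogonal_nine D₁ D₂ h₁ h₂ ho
  · intro h9
    by_cases h1 : v = 1
    · subst h1
      have h : IsCycleSystem 9 1 ∅ := by
        refine ⟨by simp, by simp, by simp, ?_⟩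
        rw [Set.sUnion_empty, Subsingleton.elim (⊤ : SimpleGraph (Fin 1)) ⊥,
          SimpleGraph.edgeSet_bot]
      exact ⟨∅, ∅, h, h, fun B hB => hB.elim⟩
    · exact (hasOrthogonalPair_of_modEq hv h1 h9).exists_orthogonal
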